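/- A coframe is a complete lattice in which arbitrary infima distribute over binary suprema; coframe morphisms preserve all infima and all finite suprema. Let $\mathbf{Frm}$ be the category of frames and $\mathbf{Top\,coFrm}$ the category of topological coframes: an object is a coframe $L$ together with a sublattice $C(L)\subseteq L$ (containing $\bot$ and $\top$) of complemented elements of $L$, called its closed elements, and a morphism is a coframe morphism mapping closed elements to closed elements. For a topological coframe $L$, the set $\bigwedge C(L)$ of all infima in $L$ of families of closed elements is a subcoframe of $L$, and $L\mapsto(\bigwedge C(L))^{op}$, acting on morphisms by restriction, is a functor $\bigwedge C^{op}\colon\mathbf{Top\,coFrm}\to\mathbf{Frm}$. For a frame $\Omega$, let $S\ell(\Omega)$ be the coframe of sublocales of $\Omega$ (subsets closed under all infima and under $a\Rightarrow(-)$ for every $a\in\Omega$), ordered by inclusion, whose closed elements are exactly the closed sublocales $\mathfrak c(u)=\{v\in\Omega\mid u\le v\}$, $u\in\Omega$; this is a topological coframe. Then: (1) For every frame morphism $\varphi\colon\Omega\to\Omega'$ there is a unique coframe morphism $S\ell(\varphi)\colon S\ell(\Omega)\to S\ell(\Omega')$ such that $S\ell(\varphi)(\mathfrak c(u))=\mathfrak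 c(\varphi(u))$ for every $u\in\Omega$, it is a morphism of topological coframes, and $S\ell\colon\mathbf{Frm}\to\mathbf{Top\,coFrm}$ is a functor. (2) For every frame $\Omega$, the map $u\mapsto\mathfrak c(u)$ is an isomorphism of frames $\Omega\cong\bigl(\bigwedge C(S\ell(\Omega))\bigr)^{op}$, natural in $\Omega$. (3) Consequently the category $\mathbf{Frm}^{op}$ of locales is a retract, up to natural isomorphism, of $(\mathbf{Top\,coFrm})^{op}$: the composite $\mathbf{Frm}^{op}\xrightarrow{S\ell^{op}}(\mathbf{Top\,coFrm})^{op}\xrightarrow{(\bigwedge C^{op})^{op}}\mathbf{Frm}^{op}$ is naturally isomorphic to the identity functor. -/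

import Mathlib

open CategoryTheory

universe u

/-! ## Coframe morphisms -/

/-- Morphisms of coframes: maps that preserve all infima and finite suprema
(that is, binary suprema and the least element). -/
structure CoframeHom (α β : Type*) [Order.Coframe α] [Order.Coframe β] extends sInfHom α β where
  map_sup' : ∀ a b : α, toFun (a ⊔ b) = toFun a ⊔ toFun b
  map_bot' : toFun ⊥ = ⊥

namespace CoframeHom

variable {α β γ : Type*} [Order.Coframe α] [Order.Coframe β] [Order.Coframe γ]

instance : FunLike (CoframeHom α β) α β where
  coe f := f.toFun
  coe_injective f g h := by
    obtain ⟨⟨_, _⟩, _, _⟩ := f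
    obtain ⟨⟨_, _⟩, _, _⟩ := g
    cases h
    rfl

@[ext]
theorem ext {f g : CoframeHom α β} (h : ∀ a, f a = g a) : f = g := DFunLike.ext f g h

theorem map_sInf (f : CoframeHom α β) (s : Set α) : f (sInf s) = sInf (f '' s) := f.map_sInf' s

theorem map_sup (f : CoframeHom α β) (a b : α) : f (a ⊔ b) = f a ⊔ f b := f.map_sup' a b

theorem map_bot (f : CoframeHom α β) : f ⊥ = ⊥ := f.map_bot'

/-- The identity coframe morphism. -/
def id (α : Type*) [Order.Coframe α] : CoframeHom α α where
  toFun a := a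
  map_sInf' s := by simp
  map_sup' _ _ := rfl
  map_bot' := rfl

/-- Composition of coframe morphisms. -/
def comp (g : CoframeHom β γ) (f : CoframeHom α β) : CoframeHom α γ where
  toFun a := g (f a)
  map_sInf' s := by rw [f.map_sInf, g.map_sInf, Set.image_image]
  map_sup' a b := by rw [f.map_sup, g.map_sup]
  map_bot' := by rw [f.map_bot, g.map_bot]

/-- A coframe morphism `α → β` is the same map seen as a frame morphism between the opposites. -/
def toDual (f : CoframeHom α β) : FrameHom αᵒᵈ βᵒᵈ where
  toFun a := OrderDual.toDual (f (OrderDual.ofDual a))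
  map_inf' a b := f.map_sup (OrderDual.ofDual a) (OrderDual.ofDual b)
  map_top' := f.map_bot
  map_sSup' s := f.map_sInf (OrderDual.toDual ⁻¹' s) |>.trans (by rfl)

end CoframeHom

/-! ## The category of topological coframes -/

/-- A topological coframe: a coframe `L` with a sublattice `C(L)` of complemented elements,
called its closed elements. Sublattices contain the empty infimum and the empty supremum. -/
structure TopCoFrm where
  carrier : Type u
  [str : Order.Coframe carrier]
  closed : Sublattice carrier
  bot_mem : ⊥ ∈ closed
  top_mem : ⊤ ∈ closed
  isComplemented : ∀ c ∈ closed, IsComplemented c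

namespace TopCoFrm

attribute [instance] TopCoFrm.str

instance : CoeSort TopCoFrm.{u} (Type u) := ⟨TopCoFrm.carrier⟩

/-- Morphisms of topological coframes: the continuous coframe morphisms, that is, those that map
closed elements to closed elements. -/
@[ext]
structure Hom (L M : TopCoFrm.{u}) where
  hom : CoframeHom L M
  map_closed : ∀ c ∈ L.closed, hom c ∈ M.closed

instance : Category TopCoFrm.{u} where
  Hom L M := Hom L M
  id L := ⟨CoframeHom.id L, fun _ h => h⟩
  comp f g := ⟨g.hom.comp f.hom, fun c h => g.map_closed _ (f.map_closed c h)⟩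

/-- `⋀ C(L)`: the set of all infima, taken in `L`, of closed elements of `L`. -/
def infClosed (L : TopCoFrm.{u}) : Set L := {x | ∃ s : Set L, s ⊆ L.closed ∧ sInf s = x}

variable {L M : TopCoFrm.{u}}

theorem sInf_mem_infClosed {t : Set L} (ht : t ⊆ L.infClosed) : sInf t ∈ L.infClosed := by
  refine ⟨{c | c ∈ L.closed ∧ ∃ x ∈ t, x ≤ c}, fun c hc => hc.1, le_antisymm ?_ ?_⟩
  · refine le_sInf fun x hx => ?_
    obtain ⟨s, hs, rfl⟩ := ht hx
    exact le_sInf fun c hc => sInf_le ⟨hs hc, _, hx, sInf_le hc⟩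
  · exact le_sInf fun c ⟨_, x, hx, hxc⟩ => (sInf_le hx).trans hxc

theorem bot_mem_infClosed : (⊥ : L) ∈ L.infClosed :=
  ⟨{⊥}, by simpa using L.bot_mem, sInf_singleton⟩

theorem sup_mem_infClosed {x y : L} (hx : x ∈ L.infClosed) (hy : y ∈ L.infClosed) :
    x ⊔ y ∈ L.infClosed := by
  obtain ⟨s, hs, rfl⟩ := hx
  obtain ⟨t, ht, rfl⟩ := hy
  refine ⟨Set.image2 (· ⊔ ·) s t, ?_, ?_⟩
  · rintro _ ⟨a, ha, b, hb, rfl⟩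
    exact L.closed.sup_mem (hs ha) (ht hb)
  · refine le_antisymm ?_ ?_
    · rw [sInf_sup_sInf]
      exact le_iInf₂ fun p hp => sInf_le ⟨p.1, hp.1, p.2, hp.2, rfl⟩
    · refine le_sInf ?_
      rintro _ ⟨a, ha, b, hb, rfl⟩
      exact sup_le_sup (sInf_le ha) (sInf_le hb)

instance : InfSet L.infClosed where
  sInf t := ⟨sInf (Subtype.val '' t), sInf_mem_infClosed (by rintro _ ⟨x, _, rfl⟩; exact x.2)⟩

/-- `⋀ C(L)` is a complete lattice for the order induced by `L`, with infima, binary suprema and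
least element computed in `L`. -/
instance : CompleteLattice L.infClosed where
  __ := completeLatticeOfInf L.infClosed fun t =>
    ⟨fun x hx => (sInf_le (Set.mem_image_of_mem _ hx) : _ ≤ x.1),
      fun x hx => (le_sInf (by rintro _ ⟨y, hy, rfl⟩; exact hx hy) : x.1 ≤ _)⟩
  sup x y := ⟨x.1 ⊔ y.1, sup_mem_infClosed x.2 y.2⟩
  le_sup_left x y := (le_sup_left : x.1 ≤ x.1 ⊔ y.1)
  le_sup_right x y := (le_sup_right : y.1 ≤ x.1 ⊔ y.1)
  sup_le x y z h h' := (sup_le h h' : x.1 ⊔ y.1 ≤ z.1)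
  bot := ⟨⊥, bot_mem_infClosed⟩
  bot_le x := (bot_le : ⊥ ≤ x.1)

/-- `⋀ C(L)` is a coframe, for the order induced by `L`. -/
instance : Order.Coframe L.infClosed := .ofMinimalAxioms {
  iInf_sup_le_sup_sInf a t := by
    change (⨅ b ∈ t, a ⊔ b).1 ≤ a.1 ⊔ sInf (Subtype.val '' t)
    rw [sup_sInf_eq, iInf_image]
    exact le_iInf₂ fun b hb => (iInf₂_le b hb : ⨅ b ∈ t, a ⊔ b ≤ a ⊔ b) }

theorem map_mem_infClosed (f : L ⟶ M) {x : L} (hx : x ∈ L.infClosed) :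
    f.hom x ∈ M.infClosed := by
  obtain ⟨s, hs, rfl⟩ := hx
  refine ⟨f.hom '' s, ?_, by rw [f.hom.map_sInf]⟩
  rintro _ ⟨c, hc, rfl⟩
  exact f.map_closed c (hs hc)

/-- The restriction of a continuous coframe morphism to `⋀ C(L) → ⋀ C(M)`. -/
def restrict (f : L ⟶ M) : CoframeHom L.infClosed M.infClosed where
  toFun x := ⟨f.hom x.1, map_mem_infClosed f x.2⟩
  map_sInf' t := Subtype.ext <| by
    change f.hom (sInf (Subtype.val '' t)) = sInf (Subtype.val '' (_ '' t))
    rw [f.hom.map_sInf, Set.image_image, Set.image_image]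
  map_sup' x y := Subtype.ext (f.hom.map_sup x.1 y.1)
  map_bot' := Subtype.ext f.hom.map_bot

/-- The functor `L ↦ (⋀ C(L))ᵒᵖ` from topological coframes to frames; it acts on morphisms by
restriction. -/
def infClosedOp : TopCoFrm.{u} ⥤ Frm.{u} where
  obj L := Frm.of (L.infClosed)ᵒᵈ
  map f := Frm.ofHom (restrict f).toDual
  map_id _ := rfl
  map_comp _ _ := rfl

end TopCoFrm

/-! ## The topological coframe of sublocales -/

section

variable {Ω : Type u} [Order.Frame Ω]

/-- The closed sublocale `𝔠(u) = ↑u`. -/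
def closedSublocale (u : Ω) : Sublocale Ω where
  carrier := Set.Ici u
  sInf_mem' _ hs := le_sInf hs
  himp_mem' _ _ hb := le_trans hb le_himp

/-- The open sublocale `𝔬(u) = {u ⇨ v | v ∈ Ω}`. -/
def openSublocale (u : Ω) : Sublocale Ω where
  carrier := Set.range fun v => u ⇨ v
  sInf_mem' s hs := by
    refine ⟨sInf s, le_antisymm (le_sInf fun x hx => ?_) le_himp⟩
    obtain ⟨v, rfl⟩ := hs hx
    exact (himp_le_himp_left (sInf_le hx)).trans (himp_idem.le)
  himp_mem' a b := by
    rintro ⟨v, rfl⟩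
    exact ⟨a ⇨ v, himp_left_comm u a v⟩

theorem mem_closedSublocale {u x : Ω} : x ∈ closedSublocale u ↔ u ≤ x := Iff.rfl

theorem mem_openSublocale {u x : Ω} : x ∈ openSublocale u ↔ ∃ v, u ⇨ v = x := Iff.rfl

theorem isCompl_closedSublocale (u : Ω) : IsCompl (closedSublocale u) (openSublocale u) where
  disjoint T hc ho x hx := by
    obtain ⟨v, rfl⟩ := ho hx
    have h : u ≤ u ⇨ v := hc hx
    rw [le_himp_iff, inf_idem] at h
    change u ⇨ v ∈ _
    rw [himp_eq_top_iff.2 h]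
    exact Sublocale.top_mem
  codisjoint T hc ho x _ := by
    have h : x = (u ⊔ x) ⊓ (u ⇨ x) := by
      rw [inf_sup_right, inf_himp, inf_eq_left.2 (le_himp : x ≤ u ⇨ x), sup_eq_right.2 inf_le_right]
    rw [h]
    exact Sublocale.inf_mem (hc (le_sup_left : u ≤ u ⊔ x)) (ho ⟨x, rfl⟩)

theorem closedSublocale_sup (u v : Ω) :
    closedSublocale (u ⊔ v) = closedSublocale u ⊓ closedSublocale v := by
  refine le_antisymm (le_inf (fun x hx => le_sup_left.trans hx) fun x hx => le_sup_right.trans hx)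
    fun x hx => sup_le ?_ ?_
  · exact (inf_le_left : closedSublocale u ⊓ closedSublocale v ≤ _) hx
  · exact (inf_le_right : closedSublocale u ⊓ closedSublocale v ≤ _) hx

theorem closedSublocale_inf (u v : Ω) :
    closedSublocale (u ⊓ v) = closedSublocale u ⊔ closedSublocale v := by
  refine le_antisymm (fun x hx => ?_)
    (sup_le (fun x hx => inf_le_left.trans hx) fun x hx => inf_le_right.trans hx)
  have h : x = (u ⊔ x) ⊓ (v ⊔ x) := by
    rw [← sup_inf_right, sup_eq_right.2 (mem_closedSublocale.1 hx)]
  rw [h]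
  exact Sublocale.inf_mem
    ((le_sup_left : closedSublocale u ≤ closedSublocale u ⊔ closedSublocale v) le_sup_left)
    ((le_sup_right : closedSublocale v ≤ closedSublocale u ⊔ closedSublocale v) le_sup_left)

end

/-- The topological coframe `Sℓ(Ω)` of sublocales of the frame `Ω`, ordered by inclusion; its closed
elements are exactly the closed sublocales. -/
def Sl (Ω : Frm.{u}) : TopCoFrm.{u} where
  carrier := Sublocale Ω
  closed :=
    { carrier := Set.range closedSublocale
      supClosed' := by
        rintro _ ⟨u, rfl⟩ _ ⟨v, rfl⟩
        exact ⟨u ⊓ v, closedSublocale_inf u v⟩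
      infClosed' := by
        rintro _ ⟨u, rfl⟩ _ ⟨v, rfl⟩
        exact ⟨u ⊔ v, closedSublocale_sup u v⟩ }
  bot_mem := ⟨⊤, le_bot_iff.1 fun x hx => by
    rw [top_le_iff.1 (mem_closedSublocale.1 hx)]
    exact Sublocale.top_mem⟩
  top_mem := ⟨⊥, top_le_iff.1 fun _ _ => mem_closedSublocale.2 bot_le⟩
  isComplemented := by
    rintro _ ⟨u, rfl⟩
    exact ⟨openSublocale u, isCompl_closedSublocale u⟩

/-!
The sublocales of a frame `Ω` are generated, under infima, by the sublocales
`𝔠(b) ⊔ 𝔬(a) = {x | b ⊓ (a ⇨ x) ≤ x}` (`Sublocale.eq_sInf_basic`): if `j` is the nucleus of `S`, then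
`S` is the infimum of the sublocales `𝔠(j a) ⊔ 𝔬(a)`. Everything below rests on this fact.

*Uniqueness.* A coframe morphism preserves complements, so its values on closed sublocales determine
its values on open sublocales, hence on the generators, hence everywhere.

*Existence.* Let `f` be the right adjoint of a frame morphism `φ : Ω → Ω'`. The localic preimage of a
sublocale `S` is `{t | ∀ y, f (y ⇨ t) ∈ S}`, the largest sublocale of `Ω'` that `f` maps into `S`. It
visibly preserves infima. By the Frobenius identity `f (φ a ⇨ t) = a ⇨ f t` it sends the generator
`𝔠(b) ⊔ 𝔬(a)` to `𝔠(φ b) ⊔ 𝔬(φ a)`. Since generators are closed under binary suprema, and since infima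
distribute over binary suprema, it preserves binary suprema too.

*The isomorphism.* An infimum of closed sublocales is closed, `⨅ 𝔠(u i) = 𝔠(⨆ u i)`, so
`⋀ C(Sℓ(Ω))` consists of the closed sublocales only, and `u ↦ 𝔠(u)` reverses and reflects the order.
-/

/-! ### Generators of the coframe of sublocales -/

namespace Sublocale

variable {Ω : Type*} [Order.Frame Ω]

theorem mem_sInf {𝒮 : Set (Sublocale Ω)} {x : Ω} : x ∈ sInf 𝒮 ↔ ∀ S ∈ 𝒮, x ∈ S := by
  refine ⟨fun h S hS => (sInf_le hS : sInf 𝒮 ≤ S) h, fun h => ?_⟩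
  let I : Sublocale Ω :=
    { carrier := {x | ∀ S ∈ 𝒮, x ∈ S}
      sInf_mem' := fun s hs S hS => S.sInf_mem fun x hx => hs hx S hS
      himp_mem' := fun _ _ hb S hS => S.himp_mem (hb S hS) }
  have hI : I ≤ sInf 𝒮 := le_sInf fun S hS x hx => hx S hS
  exact hI h

/-- The sublocale of all `x` with `b ⊓ (a ⇨ x) ≤ x`. It is `𝔠(b) ⊔ 𝔬(a)`, see
`closedSublocale_sup_openSublocale`, and it is the largest sublocale on which `b` is forced to lie
below `a`. -/
def basic (a b : Ω) : Sublocale Ω where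
  carrier := {x | b ⊓ (a ⇨ x) ≤ x}
  sInf_mem' s hs := le_sInf fun x hx =>
    (inf_le_inf_left b (himp_le_himp_left (sInf_le hx))).trans (hs hx)
  himp_mem' y x hx := by
    change b ⊓ (a ⇨ x) ≤ x at hx
    change b ⊓ (a ⇨ y ⇨ x) ≤ y ⇨ x
    rw [himp_left_comm, le_himp_iff, inf_assoc, inf_comm (y ⇨ a ⇨ x), inf_himp]
    exact (inf_le_inf_left b inf_le_right).trans hx

theorem mem_basic {a b x : Ω} : x ∈ basic a b ↔ b ⊓ (a ⇨ x) ≤ x := Iff.rfl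

/-- Every sublocale is an infimum of generators. -/
theorem eq_sInf_basic (S : Sublocale Ω) :
    S = sInf {T | S ≤ T ∧ ∃ a b, T = basic a b} := by
  refine le_antisymm (le_sInf fun T hT => hT.1) fun x hx => ?_
  -- `j` is the value at `x` of the nucleus of `S`
  set j := sInf {s | s ∈ S ∧ x ≤ s}
  have hjS : j ∈ S := S.sInf_mem fun s hs => hs.1
  have hS : S ≤ basic x j := fun s hs => by
    have h : j ≤ (x ⇨ s) ⇨ s :=
      sInf_le ⟨S.himp_mem hs, by rw [le_himp_iff, inf_himp]; exact inf_le_right⟩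
    exact le_himp_iff.1 h
  have h : j ⊓ (x ⇨ x) ≤ x := mem_sInf.1 hx _ ⟨hS, x, j, rfl⟩
  rw [himp_self, inf_top_eq] at h
  rwa [le_antisymm (le_sInf fun s hs => hs.2) h]

end Sublocale

section

variable {Ω : Type u} [Order.Frame Ω]

theorem closedSublocale_sup_openSublocale (a b : Ω) :
    closedSublocale b ⊔ openSublocale a = Sublocale.basic a b := by
  refine le_antisymm (sup_le (fun x hx => inf_le_left.trans hx) ?_) fun x hx => ?_
  · rintro _ ⟨v, rfl⟩
    rw [Sublocale.mem_basic, himp_idem]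
    exact inf_le_right
  · have h : x = (b ⊔ x) ⊓ (a ⇨ x) := by
      rw [inf_sup_right, inf_eq_left.2 (le_himp : x ≤ a ⇨ x),
        sup_eq_right.2 (Sublocale.mem_basic.1 hx)]
    rw [h]
    exact Sublocale.inf_mem
      ((le_sup_left : closedSublocale b ≤ closedSublocale b ⊔ openSublocale a) le_sup_left)
      ((le_sup_right : openSublocale a ≤ closedSublocale b ⊔ openSublocale a) ⟨x, rfl⟩)

theorem openSublocale_sup (a b : Ω) :
    openSublocale (a ⊔ b) = openSublocale a ⊔ openSublocale b := by
  have h := (isCompl_closedSublocale a).symm.sup_inf (isCompl_closedSublocale b).symm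
  rw [← closedSublocale_sup] at h
  exact (isCompl_closedSublocale (a ⊔ b)).right_unique h.symm

theorem Sublocale.basic_sup_basic (a b c d : Ω) :
    basic a b ⊔ basic c d = basic (a ⊔ c) (b ⊓ d) := by
  simp only [← closedSublocale_sup_openSublocale, closedSublocale_inf, openSublocale_sup]
  exact sup_sup_sup_comm _ _ _ _

theorem closedSublocale_top : closedSublocale (⊤ : Ω) = ⊥ :=
  le_bot_iff.1 fun x hx => by
    rw [top_le_iff.1 (mem_closedSublocale.1 hx)]
    exact Sublocale.top_mem

theorem sInf_image_closedSublocale (s : Set Ω) :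
    sInf (closedSublocale '' s) = closedSublocale (sSup s) := by
  ext x
  simp [Sublocale.mem_sInf, mem_closedSublocale]

theorem closedSublocale_le_closedSublocale {u v : Ω} :
    closedSublocale u ≤ closedSublocale v ↔ v ≤ u :=
  ⟨fun h => h (le_refl u), fun h _ hx => h.trans hx⟩

end

/-! ### Coframe morphisms out of the coframe of sublocales -/

namespace CoframeHom

variable {α β : Type*} [Order.Coframe α] [Order.Coframe β]

theorem map_isCompl (g : CoframeHom α β) {x y : α} (h : IsCompl x y) : IsCompl (g x) (g y) := by
  refine IsCompl.of_eq ?_ ?_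
  · have := g.map_sInf {x, y}
    rw [Set.image_pair, sInf_pair, sInf_pair] at this
    rw [← this, h.inf_eq_bot, g.map_bot]
  · have := g.map_sInf ∅
    rw [Set.image_empty, sInf_empty, sInf_empty] at this
    rw [← g.map_sup, h.sup_eq_top, this]

variable {Ω : Type u} [Order.Frame Ω]

/-- A coframe morphism on sublocales is determined by its values on closed sublocales: complements,
and therefore open sublocales and all generators, come along. -/
theorem ext_closedSublocale {g h : CoframeHom (Sublocale Ω) β}
    (H : ∀ u, g (closedSublocale u) = h (closedSublocale u)) : g = h := by
  have Ho (u : Ω) : g (openSublocale u) = h (openSublocale u) :=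
    (g.map_isCompl (isCompl_closedSublocale u)).right_unique
      (H u ▸ h.map_isCompl (isCompl_closedSublocale u))
  ext S
  rw [S.eq_sInf_basic, g.map_sInf, h.map_sInf]
  congr 1
  refine Set.image_congr ?_
  rintro _ ⟨-, a, b, rfl⟩
  rw [← closedSublocale_sup_openSublocale, g.map_sup, h.map_sup, H, Ho]

end CoframeHom

/-! ### Localic preimages -/

namespace FrameHom

variable {Ω Ω' : Type u} [Order.Frame Ω] [Order.Frame Ω'] (φ : FrameHom Ω Ω')

/-- The right adjoint of a frame morphism, that is, the underlying map of the corresponding morphism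
of locales. -/
def rightAdjoint (t : Ω') : Ω := sSup {u | φ u ≤ t}

theorem gc_rightAdjoint : GaloisConnection φ φ.rightAdjoint := fun u t => by
  refine ⟨fun h => le_sSup h, fun h => (OrderHomClass.mono φ h).trans ?_⟩
  rw [rightAdjoint, map_sSup]
  exact sSup_le (by rintro _ ⟨v, hv, rfl⟩; exact hv)

/-- The Frobenius identity. -/
theorem rightAdjoint_himp (a : Ω) (t : Ω') :
    φ.rightAdjoint (φ a ⇨ t) = a ⇨ φ.rightAdjoint t :=
  eq_of_forall_le_iff fun u => by
    rw [← φ.gc_rightAdjoint u, le_himp_iff, ← map_inf, φ.gc_rightAdjoint, le_himp_iff]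

/-- The preimage of a sublocale under the morphism of locales given by `φ`: the largest sublocale that
the right adjoint of `φ` maps into `S`. The set-theoretic preimage need not be
closed under `y ⇨ (-)`, hence the quantification over `y`. -/
def preimage (S : Sublocale Ω) : Sublocale Ω' where
  carrier := {t | ∀ y, φ.rightAdjoint (y ⇨ t) ∈ S}
  sInf_mem' s hs y := by
    rw [sInf_eq_iInf, himp_iInf_eq]
    simp only [himp_iInf_eq]
    rw [φ.gc_rightAdjoint.u_iInf₂]
    exact Sublocale.iInf_mem fun t => Sublocale.iInf_mem fun ht => hs ht y
  himp_mem' a b hb y := by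
    rw [himp_himp]
    exact hb _

variable {φ} in
theorem mem_preimage {S : Sublocale Ω} {t : Ω'} :
    t ∈ φ.preimage S ↔ ∀ y, φ.rightAdjoint (y ⇨ t) ∈ S := Iff.rfl

theorem preimage_sInf (𝒮 : Set (Sublocale Ω)) : φ.preimage (sInf 𝒮) = sInf (φ.preimage '' 𝒮) := by
  ext t
  simp only [mem_preimage, Sublocale.mem_sInf, Set.forall_mem_image]
  exact ⟨fun h S hS y => h y S hS, fun h y S hS => h hS y⟩

theorem preimage_mono : Monotone φ.preimage := fun _ _ h _ ht y => h (ht y)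

theorem preimage_closedSublocale (u : Ω) :
    φ.preimage (closedSublocale u) = closedSublocale (φ u) := by
  ext t
  simp only [mem_preimage, mem_closedSublocale, ← φ.gc_rightAdjoint _ _]
  exact ⟨fun h => by simpa using h ⊤, fun h y => h.trans le_himp⟩

theorem preimage_basic (a b : Ω) :
    φ.preimage (Sublocale.basic a b) = Sublocale.basic (φ a) (φ b) := by
  ext t
  have key (y : Ω') : φ.rightAdjoint (y ⇨ t) ∈ Sublocale.basic a b ↔
      φ.rightAdjoint (y ⇨ φ a ⇨ t) ≤ φ.rightAdjoint (y ⇨ φ b ⇨ t) := by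
    rw [Sublocale.mem_basic, inf_comm, ← le_himp_iff, ← rightAdjoint_himp, ← rightAdjoint_himp,
      himp_left_comm (φ a) y, himp_left_comm (φ b) y]
  simp only [mem_preimage, key, Sublocale.mem_basic]
  rw [inf_comm, ← le_himp_iff]
  refine ⟨fun h => ?_, fun h y => φ.gc_rightAdjoint.monotone_u (himp_le_himp_left h)⟩
  -- the instance `y = φ a ⇨ t` has left-hand side `⊤`
  have h := h (φ a ⇨ t)
  rw [himp_self, φ.gc_rightAdjoint.u_top, ← φ.gc_rightAdjoint, map_top, top_le_iff,
    himp_eq_top_iff] at h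
  exact h

theorem preimage_sup (S T : Sublocale Ω) : φ.preimage (S ⊔ T) = φ.preimage S ⊔ φ.preimage T := by
  refine le_antisymm ?_ (φ.preimage_mono.le_map_sup S T)
  conv_rhs => rw [S.eq_sInf_basic, T.eq_sInf_basic, preimage_sInf, preimage_sInf, sInf_sup_sInf]
  refine le_iInf₂ ?_
  rintro ⟨_, _⟩ ⟨⟨_, ⟨hS, a, b, rfl⟩, rfl⟩, ⟨_, ⟨hT, c, d, rfl⟩, rfl⟩⟩
  refine (φ.preimage_mono (sup_le_sup hS hT)).trans_eq ?_
  simp only [Sublocale.basic_sup_basic, preimage_basic, map_sup, map_inf]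

/-- The localic preimage as a coframe morphism. -/
def preimageHom : CoframeHom (Sublocale Ω) (Sublocale Ω') where
  toFun := φ.preimage
  map_sInf' := φ.preimage_sInf
  map_sup' := φ.preimage_sup
  map_bot' := by rw [← closedSublocale_top, preimage_closedSublocale, map_top, closedSublocale_top]

theorem preimageHom_closedSublocale (u : Ω) :
    φ.preimageHom (closedSublocale u) = closedSublocale (φ u) := φ.preimage_closedSublocale u

end FrameHom

/-! ### The functor of sublocales and its retraction -/

/-- The action of `Sℓ` on morphisms, by localic preimage. -/
def slMap {Ω Ω' : Frm.{u}} (φ : Ω ⟶ Ω') : Sl Ω ⟶ Sl Ω' where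
  hom := φ.hom.preimageHom
  map_closed := by
    rintro _ ⟨u, rfl⟩
    exact ⟨φ u, (φ.hom.preimageHom_closedSublocale u).symm⟩

theorem slMap_closedSublocale {Ω Ω' : Frm.{u}} (φ : Ω ⟶ Ω') (u : Ω) :
    (slMap φ).hom (closedSublocale u) = closedSublocale (φ u) :=
  φ.hom.preimageHom_closedSublocale u

theorem eq_slMap_hom_iff {Ω Ω' : Frm.{u}} (φ : Ω ⟶ Ω')
    (g : CoframeHom (Sublocale Ω) (Sublocale Ω')) :
    (∀ u : Ω, g (closedSublocale u) = closedSublocale (φ u)) ↔ g = (slMap φ).hom :=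
  ⟨fun h => CoframeHom.ext_closedSublocale fun u => (h u).trans (slMap_closedSublocale φ u).symm,
    fun h u => h ▸ slMap_closedSublocale φ u⟩

theorem slMap_id (Ω : Frm.{u}) : slMap (𝟙 Ω) = 𝟙 (Sl Ω) :=
  TopCoFrm.Hom.ext ((eq_slMap_hom_iff (𝟙 Ω) (CoframeHom.id _)).1 fun _ => rfl).symm

theorem slMap_comp {Ω Ω' Ω'' : Frm.{u}} (φ : Ω ⟶ Ω') (ψ : Ω' ⟶ Ω'') :
    slMap (φ ≫ ψ) = slMap φ ≫ slMap ψ :=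
  TopCoFrm.Hom.ext ((eq_slMap_hom_iff (φ ≫ ψ) ((slMap ψ).hom.comp (slMap φ).hom)).1 fun u =>
    (congrArg (slMap ψ).hom (slMap_closedSublocale φ u)).trans (slMap_closedSublocale ψ (φ u))).symm

/-- The functor `Sℓ` from frames to topological coframes. -/
def slFunctor : Frm.{u} ⥤ TopCoFrm.{u} where
  obj := Sl
  map := slMap
  map_id := slMap_id
  map_comp := slMap_comp

theorem closedSublocale_mem_infClosed {Ω : Frm.{u}} (u : Ω) :
    closedSublocale u ∈ (Sl Ω).infClosed :=
  ⟨{closedSublocale u}, by rintro _ rfl; exact ⟨u, rfl⟩, sInf_singleton⟩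

theorem exists_closedSublocale_eq {Ω : Frm.{u}} {S : Sublocale Ω} (hS : S ∈ (Sl Ω).infClosed) :
    ∃ u : Ω, closedSublocale u = S := by
  obtain ⟨s, hs, rfl⟩ := hS
  obtain ⟨t, rfl⟩ := Set.subset_range_iff_exists_image_eq.1 hs
  exact ⟨sSup t, (sInf_image_closedSublocale t).symm⟩

/-- The order isomorphism `u ↦ 𝔠(u)` from `Ω` onto `(⋀ C(Sℓ(Ω)))ᵒᵖ`. -/
noncomputable def closedSublocaleIso (Ω : Frm.{u}) : Ω ≃o ((Sl Ω).infClosed)ᵒᵈ :=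
  RelIso.ofSurjective
    (OrderEmbedding.ofMapLEIff
      (fun u : Ω => OrderDual.toDual (⟨closedSublocale u, closedSublocale_mem_infClosed u⟩ :
        (Sl Ω).infClosed))
      fun _ _ => closedSublocale_le_closedSublocale)
    fun S => by
      obtain ⟨u, hu⟩ := exists_closedSublocale_eq (OrderDual.ofDual S).2
      exact ⟨u, congrArg OrderDual.toDual (Subtype.ext hu)⟩

/-- The isomorphisms `u ↦ 𝔠(u)` are natural. -/
noncomputable def closedSublocaleNatIso : 𝟭 Frm.{u} ≅ slFunctor ⋙ TopCoFrm.infClosedOp :=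
  NatIso.ofComponents (fun Ω => Frm.Iso.mk (closedSublocaleIso Ω)) fun φ =>
    Frm.ext fun u => congrArg OrderDual.toDual (Subtype.ext (slMap_closedSublocale φ u).symm)

theorem mainTheorem11 :
    ∃ (SlMap : ∀ {Ω Ω' : Frm.{u}}, (Ω ⟶ Ω') → (Sl Ω ⟶ Sl Ω'))
      (map_id : ∀ Ω : Frm.{u}, SlMap (𝟙 Ω) = 𝟙 (Sl Ω))
      (map_comp : ∀ {Ω Ω' Ω'' : Frm.{u}} (φ : Ω ⟶ Ω') (ψ : Ω' ⟶ Ω''),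
        SlMap (φ ≫ ψ) = SlMap φ ≫ SlMap ψ),
      -- `Sℓ(φ)` is the unique coframe morphism that sends `𝔠(u)` to `𝔠(φ(u))` for every `u`
      (∀ {Ω Ω' : Frm.{u}} (φ : Ω ⟶ Ω') (g : CoframeHom (Sublocale Ω) (Sublocale Ω')),
        (∀ u : Ω, g (closedSublocale u) = closedSublocale (φ u)) ↔ g = (SlMap φ).hom) ∧
      let S : Frm.{u} ⥤ TopCoFrm.{u} :=
        { obj := Sl, map := SlMap, map_id := map_id, map_comp := map_comp }
      -- `u ↦ 𝔠(u)` is an isomorphism of frames `Ω ≅ (⋀ C(Sℓ(Ω)))ᵒᵖ`, natural in `Ω`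
      (∃ η : 𝟭 Frm.{u} ≅ S ⋙ TopCoFrm.infClosedOp, ∀ (Ω : Frm.{u}) (u : Ω),
        (OrderDual.ofDual (α := (Sl Ω).infClosed) (η.hom.app Ω u)).1 = closedSublocale u) ∧
      -- locales are a retract of the opposite of topological coframes, up to natural isomorphism
      Nonempty (S.op ⋙ TopCoFrm.infClosedOp.op ≅ 𝟭 Frm.{u}ᵒᵖ) := by
  refine ⟨slMap, slMap_id, slMap_comp, eq_slMap_hom_iff,
    ⟨closedSublocaleNatIso, fun _ _ => rfl⟩, ⟨?_⟩⟩
  exact (NatIso.op closedSublocaleNatIso : (slFunctor ⋙ TopCoFrm.infClosedOp).op ≅ (𝟭 Frm.{u}).op) ≪≫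
    Functor.opId Frm.{u}
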